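/- Let $\mathcal H$ be an infinite-dimensional complex Hilbert space, let $\mathcal B(\mathcal H)$ and $\mathcal K(\mathcal H)$ be the spaces of bounded and of compact linear operators on $\mathcal H$, and let $\|\cdot\|_\infty$ be the operator norm. For $x\in\mathcal B(\mathcal H)$ let $|x|=(x^*x)^{1/2}$ and $\|x\|_1=\tau(|x|)\in[0,\infty]$, where $\tau(y)=\sum_{j}(y\varphi_j,\varphi_j)$ for $y\ge 0$ and an orthonormal basis $(\varphi_j)$ of $\mathcal H$, and let $\mathcal C^1=\{x\in\mathcal K(\mathcal H):\|x\|_1<\infty\}$. A linear map $T:\mathcal B(\mathcal H)\to\mathcal B(\mathcal H)$ is called a Dunford–Schwartz operator if $\|T(x)\|_1\le\|x\|_1$ for all $x\in\mathcal C^1$ and $\|T(x)\|_\infty\le\|x\|_\infty$ for all $x\in\mathcal B(\mathcal H)$. For such a $T$ put $$A_n(T)(x)=\frac1{n+1}\sum_{k=0}^{n}T^k(x).$$ Theorem. Let $T$ be a Dunford–Schwartz operator and let $x\in\mathcal K(\mathcal H)$. Then there exists $\widehat x\in\mathcal K(\mathcal H)$ such that $\|A_n(T)(x)-\widehat x\|_\infty\to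 0$ as $n\to\infty$. -/

import Mathlib

open Filter Topology
open scoped ENNReal InnerProductSpace

namespace DunfordSchwartz

variable {H : Type*} [NormedAddCommGroup H] [InnerProductSpace ℂ H] [CompleteSpace H]

variable (H) in
/-- The index set of a fixed orthonormal (Hilbert) basis of `H`. -/
noncomputable def basisIndex : Set H := (exists_hilbertBasis ℂ H).choose

variable (H) in
/-- A fixed orthonormal (Hilbert) basis of `H`. -/
noncomputable def basis : HilbertBasis (basisIndex H) ℂ H :=
  (exists_hilbertBasis ℂ H).choose_spec.choose

/-- The canonical trace `τ(x) = ∑ⱼ (x φⱼ, φⱼ)`, with values in `[0, ∞]`, of a positive bounded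
operator `x`, where `(φⱼ)` is an orthonormal basis of `H`. It is used for positive operators only;
for these it does not depend on the basis (`trace_eq`). -/
noncomputable def trace (x : H →L[ℂ] H) : ℝ≥0∞ :=
  ∑' j, ENNReal.ofReal (RCLike.re ⟪x (basis H j), basis H j⟫_ℂ)

/-- Parseval's identity in `[0, ∞]`. -/
theorem tsum_ofReal_norm_inner_sq {ι : Type*} (b : HilbertBasis ι ℂ H) (v : H) :
    ∑' i, ENNReal.ofReal (‖⟪b i, v⟫_ℂ‖ ^ 2) = ENNReal.ofReal (‖v‖ ^ 2) := by
  have h := b.hasSum_inner_mul_inner v v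
  have h2 : HasSum (fun i => ‖⟪b i, v⟫_ℂ‖ ^ 2) (‖v‖ ^ 2) := by
    have h1 := h.mapL (RCLike.reCLM (K := ℂ))
    simp only [RCLike.reCLM_apply, inner_self_eq_norm_sq] at h1
    refine h1.congr_fun fun i => ?_
    rw [inner_mul_symm_re_eq_norm, norm_mul, norm_inner_symm v (b i), sq]
  rw [← ENNReal.ofReal_tsum_of_nonneg (fun _ => by positivity) h2.summable, h2.tsum_eq]

/-- The Hilbert–Schmidt sums of `y` and of its adjoint, in any two orthonormal bases, agree. -/
theorem tsum_ofReal_norm_sq_adjoint {ι₁ ι₂ : Type*} (b₁ : HilbertBasis ι₁ ℂ H)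
    (b₂ : HilbertBasis ι₂ ℂ H) (y : H →L[ℂ] H) :
    ∑' i, ENNReal.ofReal (‖y (b₁ i)‖ ^ 2) =
      ∑' j, ENNReal.ofReal (‖(ContinuousLinearMap.adjoint y) (b₂ j)‖ ^ 2) := by
  calc _ = ∑' i, ∑' j, ENNReal.ofReal (‖⟪b₂ j, y (b₁ i)⟫_ℂ‖ ^ 2) := by
        simp only [tsum_ofReal_norm_inner_sq]
    _ = ∑' j, ∑' i, ENNReal.ofReal (‖⟪b₂ j, y (b₁ i)⟫_ℂ‖ ^ 2) := ENNReal.tsum_comm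
    _ = _ := by
        refine tsum_congr fun j => ?_
        rw [← tsum_ofReal_norm_inner_sq b₁]
        refine tsum_congr fun i => ?_
        rw [ContinuousLinearMap.adjoint_inner_right, norm_inner_symm]

/-- The trace of a positive operator can be computed in every orthonormal basis. -/
theorem trace_eq {ι : Type*} (b : HilbertBasis ι ℂ H) {x : H →L[ℂ] H} (hx : 0 ≤ x) :
    trace x = ∑' i, ENNReal.ofReal (RCLike.re ⟪x (b i), b i⟫_ℂ) := by
  obtain ⟨y, rfl⟩ := CStarAlgebra.nonneg_iff_eq_star_mul_self.mp hx
  have key : ∀ v : H, RCLike.re ⟪(star y * y) v, v⟫_ℂ = ‖y v‖ ^ 2 := by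
    intro v
    change RCLike.re ⟪(ContinuousLinearMap.adjoint y) (y v), v⟫_ℂ = _
    rw [ContinuousLinearMap.adjoint_inner_left, inner_self_eq_norm_sq]
  simp only [trace, key]
  rw [tsum_ofReal_norm_sq_adjoint (basis H) (basis H), tsum_ofReal_norm_sq_adjoint b (basis H)]

/-- The trace norm `‖x‖₁ = τ(|x|)`, with values in `[0, ∞]`, where `|x| = (x* x)^(1/2)`. -/
noncomputable def traceNorm (x : H →L[ℂ] H) : ℝ≥0∞ := trace (CFC.abs x)

variable (H) in
/-- The trace class `𝒞¹`: the compact operators with finite trace norm. -/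
def traceClass : Set (H →L[ℂ] H) := {x | IsCompactOperator x ∧ traceNorm x < ∞}

/-- A linear map `T` on `ℬ(H)` is a Dunford–Schwartz operator if it is a contraction for the trace
norm on the trace class and a contraction for the operator norm on `ℬ(H)`. -/
structure IsDunfordSchwartz (T : (H →L[ℂ] H) →ₗ[ℂ] (H →L[ℂ] H)) : Prop where
  traceNorm_le : ∀ x ∈ traceClass H, traceNorm (T x) ≤ traceNorm x
  norm_le : ∀ x, ‖T x‖ ≤ ‖x‖

/-- The averages `Aₙ(T) = (1 / (n + 1)) ∑_{k = 0}^{n} Tᵏ`. -/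
noncomputable def average (T : (H →L[ℂ] H) →ₗ[ℂ] (H →L[ℂ] H)) (n : ℕ) :
    (H →L[ℂ] H) →ₗ[ℂ] (H →L[ℂ] H) :=
  (1 / ((n : ℂ) + 1)) • ∑ k ∈ Finset.range (n + 1), T ^ k

end DunfordSchwartz

section MeanErgodic

variable {𝕜 : Type*} [RCLike 𝕜]

/-- Hahn–Banach: a point annihilated by every functional vanishing on a subspace lies in the
closure of the subspace. -/
theorem Submodule.mem_closure_of_forall_dual {E : Type*} [NormedAddCommGroup E] [NormedSpace 𝕜 E]
    (S : Submodule 𝕜 E) (x : E)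
    (h : ∀ f : StrongDual 𝕜 E, (∀ z ∈ S, f z = 0) → f x = 0) : x ∈ closure (S : Set E) := by
  by_contra hx
  let M := S.topologicalClosure
  have hM : IsClosed (M : Set E) := S.isClosed_topologicalClosure
  have hxM : x ∉ M := hx
  have : M.mkQ x ≠ 0 := by simpa using hxM
  obtain ⟨g, -, hg⟩ := exists_dual_vector 𝕜 (M.mkQ x) (norm_ne_zero_iff.mpr this)
  have hc : Continuous (M.mkQ) := M.isOpenQuotientMap_mkQ.continuous
  let f : StrongDual 𝕜 E := g.comp ⟨M.mkQ, hc⟩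
  have h0 : f x = 0 := by
    refine h f fun z hz => ?_
    have : M.mkQ z = 0 := by simpa using S.le_topologicalClosure hz
    change g (M.mkQ z) = 0
    rw [this, map_zero]
  change g (M.mkQ x) = 0 at h0
  rw [hg] at h0
  exact this (norm_eq_zero.mp (by exact_mod_cast h0))

/-- A bounded sequence in a Hilbert space converges weakly along every ultrafilter. -/
theorem exists_forall_tendsto_dual_of_norm_le {V : Type*} [NormedAddCommGroup V]
    [InnerProductSpace 𝕜 V] [CompleteSpace V] {α : Type*} (U : Ultrafilter α) (v : α → V) {C : ℝ}
    (hv : ∀ n, ‖v n‖ ≤ C) :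
    ∃ w : V, ∀ φ : StrongDual 𝕜 V, Tendsto (fun n => φ (v n)) U (𝓝 (φ w)) := by
  let ψ : α → WeakDual 𝕜 V := fun n => StrongDual.toWeakDual (InnerProductSpace.toDual 𝕜 V (v n))
  have hK := WeakDual.isCompact_closedBall (𝕜 := 𝕜) (E := V) 0 C
  obtain ⟨l, -, hl⟩ := hK.ultrafilter_le_nhds (U.map ψ) (by
    simp only [le_principal_iff]
    refine Filter.Eventually.of_forall (fun n => ?_) (f := (U : Filter α))
    simpa [ψ] using hv n)
  refine ⟨(InnerProductSpace.toDual 𝕜 V).symm (WeakDual.toStrongDual l), fun φ => ?_⟩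
  set z := (InnerProductSpace.toDual 𝕜 V).symm φ with hz
  have hφ : ∀ u, φ u = starRingEnd 𝕜 ⟪u, z⟫_𝕜 := fun u => by
    rw [inner_conj_symm, hz, InnerProductSpace.toDual_symm_apply]
  have h1 : Tendsto (fun n => ψ n z) U (𝓝 (l z)) :=
    ((WeakDual.eval_continuous z).tendsto l).comp hl
  have h2 := (RCLike.continuous_conj (K := 𝕜)).tendsto _ |>.comp h1
  simp only [hφ, InnerProductSpace.toDual_symm_apply]
  exact h2

section Contraction

variable {E : Type*} [NormedAddCommGroup E] [NormedSpace 𝕜 E] {T : E →ₗ[𝕜] E}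

theorem LinearMap.birkhoffAverage_sub (T : E →ₗ[𝕜] E) (n : ℕ) (x y : E) :
    birkhoffAverage 𝕜 T _root_.id n (x - y) =
      birkhoffAverage 𝕜 T _root_.id n x - birkhoffAverage 𝕜 T _root_.id n y := by
  have hsub : ∀ k, T^[k] (x - y) = T^[k] x - T^[k] y := fun k => iterate_map_sub (T : E →+ E) k x y
  simp only [birkhoffAverage, birkhoffSum, id_eq, hsub, Finset.sum_sub_distrib, smul_sub]

theorem LinearMap.birkhoffAverage_apply_self (T : E →ₗ[𝕜] E) (n : ℕ) (x : E) :
    birkhoffAverage 𝕜 T _root_.id n (T x) = T (birkhoffAverage 𝕜 T _root_.id n x) := by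
  simp only [birkhoffAverage, birkhoffSum, map_smul, map_sum, id_eq,
    ← Function.iterate_succ_apply, Function.iterate_succ_apply']

theorem LinearMap.tendsto_birkhoffAverage_apply_sub (hT : LipschitzWith 1 T) (z : E) :
    Tendsto (fun n => birkhoffAverage 𝕜 T _root_.id n (T z) - birkhoffAverage 𝕜 T _root_.id n z)
      atTop (𝓝 0) := by
  refine tendsto_birkhoffAverage_apply_sub_birkhoffAverage 𝕜
    (isBounded_iff_forall_norm_le.2 ⟨‖z‖, Set.forall_mem_range.2 fun n => ?_⟩)
  have h0 : T^[n] 0 = 0 := iterate_map_zero (T : E →+ E) n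
  simpa [h0] using (hT.iterate n).dist_le_mul z 0

/-- The averages of a contraction `T` converge to `0` on the closure of the range of `T - 1`. -/
theorem LinearMap.tendsto_birkhoffAverage_zero_of_mem_closure (hT : LipschitzWith 1 T) {z : E}
    (hz : z ∈ closure (LinearMap.range (T - 1) : Set E)) :
    Tendsto (birkhoffAverage 𝕜 T _root_.id · z) atTop (𝓝 0) := by
  have hcl : IsClosed {x | Tendsto (birkhoffAverage 𝕜 T _root_.id · x) atTop (𝓝 0)} :=
    isClosed_setOfPred_tendsto_birkhoffAverage 𝕜 hT uniformContinuous_id continuous_const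
  refine closure_minimal (Set.forall_mem_range.2 fun u => ?_) hcl hz
  refine (T.tendsto_birkhoffAverage_apply_sub hT u).congr fun n => ?_
  rw [← T.birkhoffAverage_sub]
  rfl

theorem LinearMap.sub_birkhoffAverage_mem_range (T : E →ₗ[𝕜] E) (x : E) {n : ℕ} (hn : n ≠ 0) :
    x - birkhoffAverage 𝕜 T _root_.id n x ∈ LinearMap.range (T - 1) := by
  have hiter : ∀ k, x - T^[k] x ∈ LinearMap.range (T - 1) := fun k => by
    induction k with
    | zero => simp
    | succ k ih =>
      have : x - T^[k + 1] x = (x - T^[k] x) - (T - 1) (T^[k] x) := by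
        rw [Function.iterate_succ_apply', LinearMap.sub_apply, Module.End.one_apply]
        abel
      rw [this]
      exact sub_mem ih ⟨_, rfl⟩
  have hn' : (n : 𝕜) ≠ 0 := by exact_mod_cast hn
  have : x - birkhoffAverage 𝕜 T _root_.id n x =
      (n : 𝕜)⁻¹ • ∑ k ∈ Finset.range n, (x - T^[k] x) := by
    rw [Finset.sum_sub_distrib, smul_sub, Finset.sum_const, Finset.card_range,
      ← Nat.cast_smul_eq_nsmul 𝕜, smul_smul, inv_mul_cancel₀ hn', one_smul]
    rfl
  rw [this]
  exact Submodule.smul_mem _ _ (Submodule.sum_mem _ fun k _ => hiter k)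

/-- **Mean ergodic theorem** for a contraction: if the averages of the orbit of `x` have a weak
cluster point `y`, then they converge to `y` in norm. -/
theorem LinearMap.tendsto_birkhoffAverage_of_weak_clusterPt (hT : LipschitzWith 1 T) {x y : E}
    {U : Filter ℕ} [U.NeBot] (hU : U ≤ atTop)
    (hy : ∀ f : StrongDual 𝕜 E,
      Tendsto (fun n => f (birkhoffAverage 𝕜 T _root_.id n x)) U (𝓝 (f y))) :
    Tendsto (birkhoffAverage 𝕜 T _root_.id · x) atTop (𝓝 y) := by
  have hfix : T y = y := by
    rw [SeparatingDual.eq_iff_forall_dual_eq (R := 𝕜)]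
    intro f
    have h1 : Tendsto (fun n => f (T (birkhoffAverage 𝕜 T _root_.id n x)) -
        f (birkhoffAverage 𝕜 T _root_.id n x)) U (𝓝 (f (T y) - f y)) :=
      (hy (f.comp ⟨T, hT.continuous⟩)).sub (hy f)
    have h2 := (f.continuous.tendsto 0).comp
      ((T.tendsto_birkhoffAverage_apply_sub hT x).mono_left hU)
    have h3 := tendsto_nhds_unique h1 (h2.congr fun n => by
      rw [Function.comp_apply, map_sub, T.birkhoffAverage_apply_self])
    rwa [map_zero, sub_eq_zero] at h3
  have hmem : x - y ∈ closure (LinearMap.range (T - 1) : Set E) := by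
    refine Submodule.mem_closure_of_forall_dual (𝕜 := 𝕜) _ _ fun f hf => ?_
    have h1 : Tendsto (fun n => f x - f (birkhoffAverage 𝕜 T _root_.id n x)) U (𝓝 (f x - f y)) :=
      tendsto_const_nhds.sub (hy f)
    rw [map_sub]
    refine tendsto_nhds_unique h1 (tendsto_const_nhds.congr' ?_)
    filter_upwards [hU (eventually_ne_atTop 0)] with n hn
    rw [← map_sub, hf _ (T.sub_birkhoffAverage_mem_range x hn)]
  have h := tendsto_birkhoffAverage_zero_of_mem_closure hT hmem
  have hconst : Tendsto (fun n => birkhoffAverage 𝕜 T _root_.id n y) atTop (𝓝 y) := by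
    refine tendsto_const_nhds.congr' ((eventually_ne_atTop 0).mono fun n hn => ?_)
    have hy : Function.IsFixedPt T y := hfix
    exact (hy.birkhoffAverage_eq 𝕜 _root_.id (Nat.cast_ne_zero.mpr hn)).symm
  simp only [T.birkhoffAverage_sub] at h
  simpa only [sub_add_cancel, zero_add] using h.add hconst

/-- Mean ergodic theorem for a contraction `T` of a normed space and a point whose orbit is the
image of a bounded sequence under a bounded operator defined on a Hilbert space. -/
theorem LinearMap.exists_tendsto_birkhoffAverage_of_bounded_lift {V : Type*}
    [NormedAddCommGroup V] [InnerProductSpace 𝕜 V] [CompleteSpace V] (hT : LipschitzWith 1 T)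
    (J : V →L[𝕜] E) (x : E) (v : ℕ → V) {C : ℝ} (hv : ∀ n, ‖v n‖ ≤ C)
    (hx : ∀ n, J (v n) = T^[n] x) :
    ∃ y, Tendsto (birkhoffAverage 𝕜 T _root_.id · x) atTop (𝓝 y) := by
  have hC : 0 ≤ C := (norm_nonneg _).trans (hv 0)
  let a : ℕ → V := fun n => (n : 𝕜)⁻¹ • ∑ k ∈ Finset.range n, v k
  have ha : ∀ n, ‖a n‖ ≤ C := fun n => by
    rcases n.eq_zero_or_pos with rfl | hn
    · simpa [a] using hC
    have hn' : (0 : ℝ) < n := by exact_mod_cast hn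
    have h1 : ‖∑ k ∈ Finset.range n, v k‖ ≤ n * C := by
      simpa using norm_sum_le_of_le (Finset.range n) (fun k _ => hv k)
    simp only [a, norm_smul, norm_inv, RCLike.norm_natCast]
    rw [inv_mul_le_iff₀ hn']
    exact h1
  have hJa : ∀ n, J (a n) = birkhoffAverage 𝕜 T _root_.id n x := fun n => by
    simp [a, birkhoffAverage, birkhoffSum, hx]
  obtain ⟨w, hw⟩ := exists_forall_tendsto_dual_of_norm_le (𝕜 := 𝕜) (hyperfilter ℕ) a ha
  refine ⟨J w, tendsto_birkhoffAverage_of_weak_clusterPt hT (U := hyperfilter ℕ) ?_ fun f => ?_⟩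
  · rw [← Nat.cofinite_eq_atTop]
    exact hyperfilter_le_cofinite
  · simpa only [ContinuousLinearMap.comp_apply, hJa] using hw (f.comp J)

end Contraction

end MeanErgodic

/-- A compact operator into a Hilbert space is a norm limit of operators of finite rank. -/
theorem IsCompactOperator.exists_finiteDimensional_range_norm_sub_le {𝕜 E F : Type*} [RCLike 𝕜]
    [NormedAddCommGroup E] [NormedSpace 𝕜 E] [NormedAddCommGroup F] [InnerProductSpace 𝕜 F]
    {x : E →L[𝕜] F} (hx : IsCompactOperator x) {ε : ℝ} (hε : 0 < ε) :
    ∃ y : E →L[𝕜] F, FiniteDimensional 𝕜 (LinearMap.range (y : E →ₗ[𝕜] F)) ∧ ‖x - y‖ ≤ ε := by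
  have hK : TotallyBounded (x '' Metric.closedBall 0 1) :=
    ((hx.isCompact_closure_image_closedBall (𝕜₁ := 𝕜) (f := (x : E →ₗ[𝕜] F)) 1).totallyBounded).subset
      subset_closure
  obtain ⟨t, ht, hcov⟩ := Metric.totallyBounded_iff.mp hK ε hε
  let S := Submodule.span 𝕜 t
  have : FiniteDimensional 𝕜 S := FiniteDimensional.span_of_finite 𝕜 ht
  refine ⟨S.starProjection.comp x, ?_, ?_⟩
  · refine Submodule.finiteDimensional_of_le (S₂ := S) ?_
    rintro _ ⟨u, rfl⟩
    exact Submodule.starProjection_apply_mem _ _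
  · refine ContinuousLinearMap.opNorm_le_of_unit_norm hε.le fun u hu => ?_
    obtain ⟨y, hy, hxy⟩ := Set.mem_iUnion₂.mp (hcov ⟨u, by simp [hu], rfl⟩)
    have hmin := Submodule.starProjection_minimal (U := S) (x u)
    have hle : ⨅ w : S, ‖x u - w‖ ≤ ‖x u - y‖ :=
      ciInf_le (f := fun w : S => ‖x u - w‖) ⟨0, by rintro _ ⟨w, rfl⟩; exact norm_nonneg _⟩
        (⟨y, Submodule.subset_span hy⟩ : S)
    rw [Metric.mem_ball, dist_eq_norm] at hxy
    exact (hmin.trans_le hle).trans hxy.le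

namespace DunfordSchwartz

variable {H : Type*} [NormedAddCommGroup H] [InnerProductSpace ℂ H] {ι : Type*}

section HilbertSchmidt

variable (b : HilbertBasis ι ℂ H)

theorem exists_hasSum_norm_repr_smul (v : lp (fun _ : ι => H) 2) (u : H) :
    ∃ C, C ≤ ‖v‖ * ‖u‖ ∧ HasSum (fun i => ‖b.repr u i • v i‖) C := by
  have h1 := lp.hasSum_norm (by simp) (b.repr u)
  have h2 := lp.hasSum_norm (by simp) v
  obtain ⟨C, -, hC, hs⟩ := Real.inner_le_Lp_mul_Lq_hasSum_of_nonneg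
    (by simpa using Real.HolderConjugate.two_two) (norm_nonneg _) (norm_nonneg _)
    (fun i => norm_nonneg _) (fun i => norm_nonneg _) h1 h2
  rw [b.repr.norm_map, mul_comm] at hC
  exact ⟨C, hC, by simpa only [norm_smul] using hs⟩

theorem summable_repr_smul [CompleteSpace H] (v : lp (fun _ : ι => H) 2) (u : H) :
    Summable fun i => b.repr u i • v i :=
  let ⟨_, _, h⟩ := exists_hasSum_norm_repr_smul b v u
  .of_norm h.summable

theorem norm_tsum_repr_smul_le (v : lp (fun _ : ι => H) 2) (u : H) :
    ‖∑' i, b.repr u i • v i‖ ≤ ‖v‖ * ‖u‖ := by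
  obtain ⟨C, hC, h⟩ := exists_hasSum_norm_repr_smul b v u
  exact (tsum_of_norm_bounded h fun _ => le_rfl).trans hC

/-- The Hilbert–Schmidt operator with prescribed square-summable images of the basis vectors. -/
noncomputable def hilbertSchmidt [CompleteSpace H] : lp (fun _ : ι => H) 2 →L[ℂ] (H →L[ℂ] H) :=
  LinearMap.mkContinuous₂
    (LinearMap.mk₂ ℂ (fun v u => ∑' i, b.repr u i • v i)
      (fun v w u => by
        rw [← (summable_repr_smul b v u).tsum_add (summable_repr_smul b w u)]
        simp [smul_add])
      (fun c v u => by
        rw [← (summable_repr_smul b v u).tsum_const_smul c]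
        simp [smul_comm c])
      (fun v u w => by
        rw [← (summable_repr_smul b v u).tsum_add (summable_repr_smul b v w)]
        simp [add_smul])
      (fun c v u => by
        rw [← (summable_repr_smul b v u).tsum_const_smul c]
        simp [mul_smul])) 1
    (fun v u => by simpa using norm_tsum_repr_smul_le b v u)

theorem hilbertSchmidt_apply [CompleteSpace H] (v : lp (fun _ : ι => H) 2) (u : H) :
    hilbertSchmidt b v u = ∑' i, b.repr u i • v i := rfl

theorem isCompactOperator_hilbertSchmidt [CompleteSpace H] (v : lp (fun _ : ι => H) 2) :
    IsCompactOperator (hilbertSchmidt b v) := by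
  classical
  have h := (lp.hasSum_single ENNReal.ofNat_ne_top v).mapL (hilbertSchmidt b)
  refine isCompactOperator_of_tendsto h (Eventually.of_forall fun s => ?_)
  change ∑ i ∈ s, _ ∈ compactOperator (RingHom.id ℂ) H H
  refine Submodule.sum_mem _ fun i _ => ?_
  have heq : hilbertSchmidt b (lp.single 2 i (v i)) =
      (ContinuousLinearMap.toSpanSingleton ℂ (v i)).comp (innerSL ℂ (b i)) := by
    ext u
    rw [hilbertSchmidt_apply, tsum_eq_single i fun j hj => by simp [hj]]
    simp [b.repr_apply_apply]
  rw [heq]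
  exact (isCompactOperator_of_locallyCompactSpace_rng
    (ContinuousLinearMap.toSpanSingleton ℂ (v i))).comp_clm (innerSL ℂ (b i))

theorem hilbertSchmidt_eq [CompleteSpace H] {z : H →L[ℂ] H} {v : lp (fun _ : ι => H) 2}
    (hv : ∀ i, v i = z (b i)) : hilbertSchmidt b v = z := by
  ext u
  rw [hilbertSchmidt_apply]
  have h := (b.hasSum_repr u).mapL z
  simp only [map_smul, ← hv] at h
  exact h.tsum_eq

end HilbertSchmidt

variable [CompleteSpace H]

theorem norm_abs_apply (z : H →L[ℂ] H) (u : H) : ‖CFC.abs z u‖ = ‖z u‖ := by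
  have hsa : ContinuousLinearMap.adjoint (CFC.abs z) = CFC.abs z :=
    (IsSelfAdjoint.of_nonneg (CFC.abs_nonneg z)).adjoint_eq
  have h := CFC.abs_mul_abs z
  rw [ContinuousLinearMap.apply_norm_eq_sqrt_inner_adjoint_left,
    ContinuousLinearMap.apply_norm_eq_sqrt_inner_adjoint_left z, hsa]
  exact congrArg (fun w : H →L[ℂ] H => √(RCLike.re ⟪w u, u⟫_ℂ)) h

theorem norm_sq_apply_le_of_nonneg {a : H →L[ℂ] H} (ha : 0 ≤ a) (u : H) :
    ‖a u‖ ^ 2 ≤ ‖a‖ * RCLike.re ⟪a u, u⟫_ℂ := by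
  obtain ⟨y, rfl⟩ := CStarAlgebra.nonneg_iff_eq_star_mul_self.mp ha
  have h1 : RCLike.re ⟪(star y * y) u, u⟫_ℂ = ‖y u‖ ^ 2 :=
    (ContinuousLinearMap.apply_norm_sq_eq_inner_adjoint_left y u).symm
  have h2 : ‖(star y * y) u‖ ≤ ‖y‖ * ‖y u‖ := by
    rw [← norm_star y]
    exact (star y).le_opNorm (y u)
  rw [h1, CStarRing.norm_star_mul_self, ← sq, ← mul_pow]
  gcongr

theorem tsum_norm_sq_le (z : H →L[ℂ] H) :
    ∑' i, ENNReal.ofReal (‖z (basis H i)‖ ^ 2) ≤ ENNReal.ofReal ‖z‖ * traceNorm z := by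
  rw [traceNorm, trace, ← ENNReal.tsum_mul_left]
  refine ENNReal.tsum_le_tsum fun i => ?_
  rw [← ENNReal.ofReal_mul (norm_nonneg _), ← norm_abs_apply]
  refine ENNReal.ofReal_le_ofReal ?_
  have := norm_sq_apply_le_of_nonneg (CFC.abs_nonneg z) (basis H i)
  rwa [CFC.norm_abs] at this

theorem exists_hilbertSchmidt_eq {z : H →L[ℂ] H} (hz : traceNorm z < ∞) :
    ∃ v, hilbertSchmidt (basis H) v = z ∧ ‖v‖ ^ 2 ≤ ‖z‖ * (traceNorm z).toReal := by
  have h1 := tsum_norm_sq_le z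
  have hfin : ENNReal.ofReal ‖z‖ * traceNorm z ≠ ∞ := ENNReal.mul_ne_top ENNReal.ofReal_ne_top hz.ne
  have hs : Summable fun i => ‖z (basis H i)‖ ^ 2 := by
    have := ENNReal.summable_toReal (ne_top_of_le_ne_top hfin h1)
    simpa using this
  have hm : Memℓp (fun i => z (basis H i)) 2 := memℓp_gen (by simpa using hs)
  refine ⟨⟨_, hm⟩, hilbertSchmidt_eq _ fun i => rfl, ?_⟩
  have h2 := lp.norm_rpow_eq_tsum (p := 2) (by simp) (⟨_, hm⟩ : lp (fun _ => H) 2)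
  simp only [ENNReal.toReal_ofNat, Real.rpow_ofNat] at h2
  rw [h2]
  have h3 := ENNReal.toReal_mono hfin h1
  rw [ENNReal.toReal_mul, ENNReal.toReal_ofReal (norm_nonneg _),
    ← ENNReal.ofReal_tsum_of_nonneg (fun _ => by positivity) hs,
    ENNReal.toReal_ofReal (tsum_nonneg fun _ => by positivity)] at h3
  exact h3

theorem isCompactOperator_of_traceNorm_lt_top {z : H →L[ℂ] H} (hz : traceNorm z < ∞) :
    IsCompactOperator z := by
  obtain ⟨v, rfl, -⟩ := exists_hilbertSchmidt_eq hz
  exact isCompactOperator_hilbertSchmidt _ v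

/-- The Hilbert–Schmidt sum of the projection onto a finite-dimensional subspace is finite. -/
theorem tsum_norm_sq_starProjection_lt_top {ι : Type*} (b : HilbertBasis ι ℂ H) (S : Submodule ℂ H)
    [FiniteDimensional ℂ S] : ∑' i, ENNReal.ofReal (‖S.starProjection (b i)‖ ^ 2) < ∞ := by
  let f := stdOrthonormalBasis ℂ S
  have h (u : H) : ENNReal.ofReal (‖S.starProjection u‖ ^ 2) =
      ∑ k, ENNReal.ofReal (‖⟪u, (f k : H)⟫_ℂ‖ ^ 2) := by
    rw [← ENNReal.ofReal_sum_of_nonneg fun _ _ => by positivity]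
    congr 1
    rw [Submodule.starProjection_apply, Submodule.norm_coe, ← f.sum_sq_norm_inner_left]
    refine Finset.sum_congr rfl fun k _ => ?_
    rw [Submodule.coe_inner, ← Submodule.starProjection_apply,
      Submodule.inner_starProjection_left_eq_right,
      Submodule.starProjection_eq_self_iff.mpr (f k).2]
  simp only [h]
  rw [Summable.tsum_finsetSum fun _ _ => ENNReal.summable]
  simp only [tsum_ofReal_norm_inner_sq]
  exact ENNReal.sum_lt_top.mpr fun _ _ => ENNReal.ofReal_lt_top

/-- Operators of finite rank have finite trace norm. -/
theorem traceNorm_lt_top_of_finiteDimensional_range (x : H →L[ℂ] H)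
    [FiniteDimensional ℂ (LinearMap.range (x : H →ₗ[ℂ] H))] : traceNorm x < ∞ := by
  let K : Submodule ℂ H := LinearMap.ker (x : H →ₗ[ℂ] H)
  have : CompleteSpace K := x.isClosed_ker.completeSpace_coe
  have : FiniteDimensional ℂ Kᗮ := by
    refine FiniteDimensional.of_injective
      ((x : H →ₗ[ℂ] H).rangeRestrict.comp Kᗮ.subtype) ?_
    rw [← LinearMap.ker_eq_bot, LinearMap.ker_eq_bot']
    intro u hu
    have hu' : (u : H) ∈ K := congrArg Subtype.val hu
    exact Subtype.ext (Submodule.disjoint_def.mp K.orthogonal_disjoint _ hu' u.2)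
  have hpos := CFC.abs_nonneg x
  have hle (u : H) : RCLike.re ⟪CFC.abs x u, u⟫_ℂ ≤ ‖x‖ * ‖Kᗮ.starProjection u‖ ^ 2 := by
    set p := Kᗮ.starProjection u
    have hker : CFC.abs x (u - p) = 0 := by
      rw [← norm_eq_zero, norm_abs_apply, norm_eq_zero]
      have : u - p ∈ Kᗮᗮ := Submodule.sub_starProjection_mem_orthogonal u
      rw [Submodule.orthogonal_orthogonal] at this
      exact this
    have hp : CFC.abs x u = CFC.abs x p := by rwa [map_sub, sub_eq_zero] at hker
    have hsymm := ((ContinuousLinearMap.nonneg_iff_isPositive _).mp hpos).inner_left_eq_inner_right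
    rw [hp, hsymm, hp]
    calc _ ≤ ‖p‖ * ‖CFC.abs x p‖ := re_inner_le_norm _ _
      _ ≤ ‖p‖ * (‖x‖ * ‖p‖) := by
        gcongr
        exact (norm_abs_apply x p).trans_le (x.le_opNorm p)
      _ = _ := by ring
  calc traceNorm x ≤ ∑' i, ENNReal.ofReal ‖x‖ *
        ENNReal.ofReal (‖Kᗮ.starProjection (basis H i)‖ ^ 2) := by
        refine ENNReal.tsum_le_tsum fun i => ?_
        rw [← ENNReal.ofReal_mul (norm_nonneg _)]
        exact ENNReal.ofReal_le_ofReal (hle _)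
    _ < ∞ := by
        rw [ENNReal.tsum_mul_left]
        exact ENNReal.mul_lt_top ENNReal.ofReal_lt_top (tsum_norm_sq_starProjection_lt_top _ _)

end DunfordSchwartz

namespace DunfordSchwartz

variable {H : Type*} [NormedAddCommGroup H] [InnerProductSpace ℂ H] [CompleteSpace H]
  {T : (H →L[ℂ] H) →ₗ[ℂ] (H →L[ℂ] H)}

omit [CompleteSpace H] in
theorem average_apply (T : (H →L[ℂ] H) →ₗ[ℂ] (H →L[ℂ] H)) (n : ℕ) (x : H →L[ℂ] H) :
    average T n x = birkhoffAverage ℂ T _root_.id (n + 1) x := by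
  simp [average, birkhoffAverage, birkhoffSum, Module.End.pow_apply]

namespace IsDunfordSchwartz

theorem lipschitzWith_one (hT : IsDunfordSchwartz T) : LipschitzWith 1 T :=
  LipschitzWith.of_dist_le_mul fun x y => by
    rw [dist_eq_norm, dist_eq_norm, ← map_sub, NNReal.coe_one, one_mul]
    exact hT.norm_le _

theorem norm_iterate_le (hT : IsDunfordSchwartz T) (x : H →L[ℂ] H) (n : ℕ) : ‖T^[n] x‖ ≤ ‖x‖ := by
  induction n with
  | zero => exact le_rfl
  | succ n ih =>
    rw [Function.iterate_succ_apply']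
    exact (hT.norm_le _).trans ih

theorem traceNorm_iterate_le (hT : IsDunfordSchwartz T) {x : H →L[ℂ] H} (hx : traceNorm x < ∞)
    (n : ℕ) : traceNorm (T^[n] x) ≤ traceNorm x := by
  induction n with
  | zero => exact le_rfl
  | succ n ih =>
    have hfin := ih.trans_lt hx
    rw [Function.iterate_succ_apply']
    exact (hT.traceNorm_le _ ⟨isCompactOperator_of_traceNorm_lt_top hfin, hfin⟩).trans ih

/-- The averages of a trace class operator converge in operator norm. -/
theorem exists_tendsto_of_traceNorm_lt_top (hT : IsDunfordSchwartz T) {x : H →L[ℂ] H}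
    (hx : traceNorm x < ∞) :
    ∃ y, Tendsto (birkhoffAverage ℂ T _root_.id · x) atTop (𝓝 y) := by
  have hfin (n : ℕ) := (hT.traceNorm_iterate_le hx n).trans_lt hx
  choose v hv hbound using fun n => exists_hilbertSchmidt_eq (hfin n)
  refine LinearMap.exists_tendsto_birkhoffAverage_of_bounded_lift hT.lipschitzWith_one
    (hilbertSchmidt (basis H)) x v (C := √(‖x‖ * (traceNorm x).toReal)) (fun n => ?_) hv
  refine Real.le_sqrt_of_sq_le ((hbound n).trans ?_)
  gcongr
  · exact hT.norm_iterate_le x n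
  · exact hx.ne
  · exact hT.traceNorm_iterate_le hx n

end IsDunfordSchwartz

theorem mem_closure_traceNorm_lt_top {x : H →L[ℂ] H} (hx : IsCompactOperator x) :
    x ∈ closure {y : H →L[ℂ] H | traceNorm y < ∞} := by
  refine Metric.mem_closure_iff.mpr fun ε hε => ?_
  obtain ⟨y, hy, hxy⟩ := hx.exists_finiteDimensional_range_norm_sub_le (half_pos hε)
  refine ⟨y, traceNorm_lt_top_of_finiteDimensional_range y, ?_⟩
  rw [dist_eq_norm]
  linarith

namespace IsDunfordSchwartz

theorem isCompactOperator_apply (hT : IsDunfordSchwartz T) {x : H →L[ℂ] H}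
    (hx : IsCompactOperator x) : IsCompactOperator (T x) := by
  have hcl : IsClosed {y : H →L[ℂ] H | IsCompactOperator (T y)} :=
    isClosed_setOfPred_isCompactOperator.preimage hT.lipschitzWith_one.continuous
  refine closure_minimal (fun y hy => ?_) hcl (mem_closure_traceNorm_lt_top hx)
  have hy : traceNorm y < ∞ := hy
  exact isCompactOperator_of_traceNorm_lt_top ((hT.traceNorm_iterate_le hy 1).trans_lt hy)

theorem isCompactOperator_birkhoffAverage (hT : IsDunfordSchwartz T) {x : H →L[ℂ] H}
    (hx : IsCompactOperator x) (n : ℕ) :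
    IsCompactOperator (birkhoffAverage ℂ T _root_.id n x : H →L[ℂ] H) := by
  have hiter (k : ℕ) : IsCompactOperator (T^[k] x : H →L[ℂ] H) := by
    induction k with
    | zero => exact hx
    | succ k ih =>
      rw [Function.iterate_succ_apply']
      exact hT.isCompactOperator_apply ih
  exact Submodule.smul_mem (compactOperator (RingHom.id ℂ) H H) _
    (Submodule.sum_mem _ fun k _ => hiter k)

theorem exists_tendsto_birkhoffAverage (hT : IsDunfordSchwartz T) {x : H →L[ℂ] H}
    (hx : IsCompactOperator x) :
    ∃ y, Tendsto (birkhoffAverage ℂ T _root_.id · x) atTop (𝓝 y) := by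
  refine cauchySeq_tendsto_of_complete (Metric.cauchySeq_iff'.mpr fun ε hε => ?_)
  obtain ⟨y, hy, hxy⟩ := Metric.mem_closure_iff.mp (mem_closure_traceNorm_lt_top hx) (ε / 3)
    (by positivity)
  obtain ⟨z, hz⟩ := hT.exists_tendsto_of_traceNorm_lt_top hy
  obtain ⟨N, hN⟩ := Metric.cauchySeq_iff'.mp hz.cauchySeq (ε / 3) (by positivity)
  have hdist (n : ℕ) : dist (birkhoffAverage ℂ T _root_.id n x) (birkhoffAverage ℂ T _root_.id n y)
      ≤ dist x y := by
    refine (dist_birkhoffAverage_birkhoffAverage_le ℂ T _root_.id n x y).trans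
      (div_le_of_le_mul₀ n.cast_nonneg dist_nonneg ?_)
    have hk (k : ℕ) : dist (T^[k] x) (T^[k] y) ≤ dist x y := by
      simpa using (hT.lipschitzWith_one.iterate k).dist_le_mul x y
    calc ∑ k ∈ Finset.range n, dist (T^[k] x) (T^[k] y) ≤ ∑ _k ∈ Finset.range n, dist x y :=
          Finset.sum_le_sum fun k _ => hk k
      _ = dist x y * n := by simp [mul_comm]
  refine ⟨N, fun n hn => ?_⟩
  have h1 := dist_triangle4 (birkhoffAverage ℂ T _root_.id n x) (birkhoffAverage ℂ T _root_.id n y)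
    (birkhoffAverage ℂ T _root_.id N y) (birkhoffAverage ℂ T _root_.id N x)
  have h2 := hdist n
  have h3 := hdist N
  rw [dist_comm] at h3
  have h4 := hN n hn
  linarith

end IsDunfordSchwartz

end DunfordSchwartz

theorem theorem3p2 {H : Type*} [NormedAddCommGroup H] [InnerProductSpace ℂ H] [CompleteSpace H]
    (hH : ¬ FiniteDimensional ℂ H)
    (T : (H →L[ℂ] H) →ₗ[ℂ] (H →L[ℂ] H)) (hT : DunfordSchwartz.IsDunfordSchwartz T)
    (x : H →L[ℂ] H) (hx : IsCompactOperator x) :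
    ∃ x' : H →L[ℂ] H, IsCompactOperator x' ∧
      Tendsto (fun n : ℕ => ‖DunfordSchwartz.average T n x - x'‖) atTop (𝓝 0) := by
  obtain ⟨y, hy⟩ := hT.exists_tendsto_birkhoffAverage hx
  refine ⟨y, isCompactOperator_of_tendsto hy
    (Eventually.of_forall (hT.isCompactOperator_birkhoffAverage hx)), ?_⟩
  simp only [DunfordSchwartz.average_apply]
  exact tendsto_iff_norm_sub_tendsto_zero.mp (hy.comp (tendsto_add_atTop_nat 1))
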